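/- Let $q$ be a prime power, $m\ge 1$, and write $x^{[i]}=x^{q^i}$ for $x\in\mathbb F_{q^m}$, $i\in\mathbb Z$ (for $i<0$ this is the inverse Frobenius iterate); powers $[i]$ of vectors are taken coordinatewise, and for a code $C\subseteq\mathbb F_{q^m}^n$ put $C^{[i]}=\{c^{[i]}:c\in C\}$. Let $\mathcal C_{\rm pub}\subseteq\mathbb F_{q^m}^n$ be an $\mathbb F_{q^m}$-linear code of dimension $k$ (for instance a public code of Loidreau's scheme), $C=\mathcal C_{\rm pub}^\perp$ its dual, and let $\lambda\ge 2$ be an integer with $\lambda\le \frac{n}{n-k+1}$ and $2\lambda\le n-k$. Let $d=n-k-\lambda+1$. Let $\mathcal S$ be the set of all $(\mathbf h,\vec\beta)\in(\mathbb F_{q^m}^n)^\lambda\times\mathbb F_{q^m}^{\lambda-1}$, $\mathbf h=(\mathbf h_0,\dots,\mathbf h_{\lambda-1})$, $\vec\beta=(\beta_1,\dots,\beta_{\lambda-1})$, such that $$C=\Big\langle \mathbf h_0^{[i]}+\sum_{j=1}^{\lambda-1}\beta_j\mathbf h_j^{[i]},\ i=0,\dots,n-k-1\Big\rangle_{\mathbb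 F_{q^m}},$$ every $\mathbf h_j$ has rank $n$ (its coordinates span an $\mathbb F_q$-space of dimension $n$), and $1,\beta_1,\dots,\beta_{\lambda-1}$ are linearly independent over $\mathbb F_q$. Assume: 1. there is $(\mathbf h,\vec\beta)\in\mathcal S$ such that for all distinct $i_1,\dots,i_\lambda\in\{0,\dots,n-k-1\}$ the $\lambda\times\lambda$ matrix with rows $(1,\beta_1^{[i_a]},\dots,\beta_{\lambda-1}^{[i_a]})$, $a=1,\dots,\lambda$, has nonzero determinant; 2. $\dim_{\mathbb F_{q^m}}\big(C+C^{[1]}+\dots+C^{[\lambda]}\big)=\lambda(n-k)+\lambda$; 3. for the $\vec\beta$ of (1), no $A=(a_{i,j})_{i,j=0}^{\lambda-1}\in GL_\lambda(\mathbb F_q)$ with nontrivial class in $PGL_\lambda(\mathbb F_q)$ satisfies $\beta_j=\dfrac{a_{0,j}+\sum_{i=1}^{\lambda-1}a_{i,j}\beta_i}{a_{0,0}+\sum_{i=1}^{\lambda-1}a_{i,0}\beta_i}$ for all $j=1,\dots,\lambda-1$. Consider the following algorithm, applied to $C$: * $\mathcal S_0=C^{[0]}+C^{[1]}+\dots+C^{[\lambda-1]}$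 and $\mathcal A=\big(\bigcap_{i=0}^{d}\mathcal S_0^{[i]}\big)^{[-d]}$; * $\mathcal D_{\lambda-1}=\mathcal A^{[\lambda-2]}\cap C^{[\lambda-1-d]}$, $\ \mathcal B_0=\mathcal A+\mathcal D_{\lambda-1}^{[1-\lambda]}$, $\ \mathcal D_0=\mathcal B_0\cap C^{[-1]}$; * for $\ell=1,\dots,\lambda-2$: $\mathcal B_\ell=\mathcal A+\sum_{j=0}^{\ell-1}\mathcal D_j^{[\ell-j]}$, $\ \mathcal D_\ell=\mathcal B_\ell\cap C^{[-1]}$; * $\mathcal H=\sum_{j=0}^{\lambda-1}\mathcal D_j^{[2-j-\lambda]}$; for $i=0,\dots,n-k-1$ return $\mathcal A_i=\mathcal H\cap C^{[-i]}$. Then for every $(\mathbf h,\vec\beta)\in\mathcal S$ and every $i=0,\dots,n-k-1$, the returned space $\mathcal A_i$ is one-dimensional and $$\mathcal A_i=\Big\langle \mathbf h_0+\sum_{j=1}^{\lambda-1}\beta_j^{[-i]}\mathbf h_j\Big\rangle_{\mathbb F_{q^m}}.$$ In particular these spaces do not depend on the choice of $(\mathbf h,\vec\beta)\in\mathcal S$.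 -/

import Mathlib

open scoped BigOperators MatrixGroups

/-! Throughout, `F` is the finite field with `q` elements, `K` is the finite extension of `F` of
degree `m`, and `[i]` denotes the power `q ^ i` for an arbitrary integer `i`, that is, the
`i`-th power of the `q`-Frobenius automorphism of `K`. -/

namespace Loidreau

noncomputable section

section Frobenius

variable (F : Type*) {K : Type*} [Field F] [Fintype F] [Field K] [Finite K] [Algebra F K]

/-- `x ^ [i]`, where `x ^ [1] = x ^ q` and `i` is any integer. -/
def frob (i : ℤ) (x : K) : K :=
  ((FiniteField.frobeniusAlgEquivOfAlgebraic F K) ^ i : K ≃ₐ[F] K) x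

/-- The coordinatewise power `v ^ [i]` of a vector. -/
def frobVec {n : ℕ} (i : ℤ) (v : Fin n → K) : Fin n → K := fun t => frob F i (v t)

theorem frob_one (x : K) : frob F 1 x = x ^ Fintype.card F := by
  simp [frob]

theorem frob_frob_neg (i : ℤ) (x : K) : frob F i (frob F (-i) x) = x := by
  unfold frob
  rw [← AlgEquiv.mul_apply, ← zpow_add, add_neg_cancel, zpow_zero, AlgEquiv.one_apply]

/-- The Frobenius twist `C ^ [i] = {c ^ [i] : c ∈ C}` of a code. -/
def twist {n : ℕ} (i : ℤ) (C : Submodule K (Fin n → K)) : Submodule K (Fin n → K) where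
  carrier := {v | ∃ c ∈ C, v = frobVec F i c}
  add_mem' := by
    rintro _ _ ⟨c, hc, rfl⟩ ⟨c', hc', rfl⟩
    exact ⟨c + c', C.add_mem hc hc', by funext t; simp [frobVec, frob]⟩
  zero_mem' := ⟨0, C.zero_mem, by funext t; simp [frobVec, frob]⟩
  smul_mem' := by
    rintro a _ ⟨c, hc, rfl⟩
    refine ⟨frob F (-i) a • c, C.smul_mem _ hc, ?_⟩
    funext t
    have h : frob F i (frob F (-i) a * c t) =
        frob F i (frob F (-i) a) * frob F i (c t) := by simp [frob]
    simp [frobVec, h, frob_frob_neg]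

/-- The rank of a vector: the dimension over `F` of the span of its coordinates. -/
def vecRank {n : ℕ} (v : Fin n → K) : ℕ :=
  Module.finrank F (Submodule.span F (Set.range v))

end Frobenius

/-- The dual code of `C` for the standard bilinear form. -/
def dualCode {K : Type*} [Field K] {n : ℕ} (C : Submodule K (Fin n → K)) :
    Submodule K (Fin n → K) where
  carrier := {x | ∀ c ∈ C, ∑ t, c t * x t = 0}
  add_mem' := by
    intro x y hx hy c hc
    simp [mul_add, Finset.sum_add_distrib, hx c hc, hy c hc]
  zero_mem' := by intro c _; simp
  smul_mem' := by
    intro a x hx c hc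
    have h : ∑ t, c t * (a • x) t = a * ∑ t, c t * x t := by
      rw [Finset.mul_sum]
      exact Finset.sum_congr rfl fun t _ => by simp only [Pi.smul_apply, smul_eq_mul]; ring
    rw [h, hx c hc, mul_zero]

section Solutions

variable (F : Type*) {K : Type*} [Field F] [Fintype F] [Field K] [Finite K] [Algebra F K]

/-- The tuple `(1, β_1, …, β_{λ-1})`, with `λ = s + 1`. The entry `β_j` is `β ⟨j - 1, _⟩`. -/
def withOne {s : ℕ} (β : Fin s → K) : Fin (s + 1) → K := Fin.cons 1 β

/-- The vector `y^{[u,j]} = h_0^[j] + ∑_{i=1}^{λ-1} β_i^[u] h_i^[j]`. -/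
def yVec {n s : ℕ} (h : Fin (s + 1) → Fin n → K) (β : Fin s → K) (u j : ℤ) : Fin n → K :=
  frobVec F j (h 0) + ∑ i : Fin s, frob F u (β i) • frobVec F j (h i.succ)

/-- The solution set of a code `D` of length `n` (in the application, `D` is the dual of the public
code, of dimension `r = n - k`), for the parameter `λ = s + 1`. -/
def solutionSet {n : ℕ} (s r : ℕ) (D : Submodule K (Fin n → K)) :
    Set ((Fin (s + 1) → Fin n → K) × (Fin s → K)) :=
  {p | D = Submodule.span K {v | ∃ i : ℕ, i < r ∧ v = yVec F p.1 p.2 0 i} ∧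
    (∀ j, vecRank F (p.1 j) = n) ∧
    Module.finrank F (Submodule.span F (Set.range (withOne p.2))) = s + 1}

/-- The `λ × λ` matrix whose row of index `a` is `(1, β_1^[i_a], …, β_{λ-1}^[i_a])`. -/
def mooreMatrix {s : ℕ} (β : Fin s → K) (i : Fin (s + 1) → ℕ) :
    Matrix (Fin (s + 1)) (Fin (s + 1)) K :=
  Matrix.of fun a b => frob F (i a) (withOne β b)

/-- All the determinants `det (1, β_1^[i_a], …, β_{λ-1}^[i_a])_a` with distinct exponents
`i_a ∈ {0, …, r - 1}` are nonzero. -/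
def MooreNondegenerate {s : ℕ} (r : ℕ) (β : Fin s → K) : Prop :=
  ∀ i : Fin (s + 1) → ℕ, Function.Injective i → (∀ a, i a < r) →
    (mooreMatrix F β i).det ≠ 0

/-- The projective action of an invertible matrix over `F` on `(β_1, …, β_{λ-1})`:
`β_j ↦ (a_{0,j} + ∑ a_{i,j} β_i) / (a_{0,0} + ∑ a_{i,0} β_i)`. -/
def projAction {s : ℕ} (A : GL (Fin (s + 1)) F) (β : Fin s → K) : Fin s → K := fun j =>
  (algebraMap F K (A.val 0 j.succ) + ∑ i : Fin s, algebraMap F K (A.val i.succ j.succ) * β i) /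
  (algebraMap F K (A.val 0 0) + ∑ i : Fin s, algebraMap F K (A.val i.succ 0) * β i)

/-- Only the class of the identity in the projective linear group over `F` fixes `β`. -/
def TrivialStabilizer {s : ℕ} (β : Fin s → K) : Prop :=
  ∀ A : GL (Fin (s + 1)) F, projAction F A β = β →
    (Matrix.ProjGenLinGroup.mk A : Matrix.ProjGenLinGroup (Fin (s + 1)) F) = 1

end Solutions

/-! The algorithm that recovers the one-dimensional spaces. Its inputs are the code `D` (the dual
of the public code), of length `n`, the dimension `k` of the public code, and
`lam`, which stands for `λ`. -/

section Algorithm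

variable (F : Type*) {K : Type*} [Field F] [Fintype F] [Field K] [Finite K] [Algebra F K]
variable {n : ℕ} (k lam : ℕ) (D : Submodule K (Fin n → K))

/-- `S_0 = D^[0] + D^[1] + ⋯ + D^[λ-1]`. -/
def algS : Submodule K (Fin n → K) :=
  ⨆ i ∈ Finset.range lam, twist F (i : ℤ) D

/-- `d = n - k - λ + 1`. -/
def algd (n k lam : ℕ) : ℕ := n - k - lam + 1

/-- `A = (S_0^[0] ∩ S_0^[1] ∩ ⋯ ∩ S_0^[d])^[-d]`. -/
def algA : Submodule K (Fin n → K) :=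
  twist F (-(algd n k lam : ℤ))
    (⨅ i ∈ Finset.range (algd n k lam + 1), twist F (i : ℤ) (algS F lam D))

/-- `D_{λ-1} = A^[λ-2] ∩ D^[λ-1-d]`. -/
def algDLast : Submodule K (Fin n → K) :=
  twist F ((lam : ℤ) - 2) (algA F k lam D) ⊓ twist F ((lam : ℤ) - 1 - algd n k lam) D

/-- `B_0 = A + D_{λ-1}^[1-λ]`. -/
def algBZero : Submodule K (Fin n → K) :=
  algA F k lam D ⊔ twist F (1 - (lam : ℤ)) (algDLast F k lam D)

/-- The loop: `D_0 = B_0 ∩ D^[-1]`, and for `ℓ ≥ 1`, `D_ℓ = B_ℓ ∩ D^[-1]` with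
`B_ℓ = A + ∑_{j=0}^{ℓ-1} D_j^[ℓ-j]`. Only the indices `ℓ ≤ λ - 2` are used. -/
def algD (l : ℕ) : Submodule K (Fin n → K) :=
  (if l = 0 then algBZero F k lam D
    else algA F k lam D ⊔ ⨆ j : Fin l, twist F ((l : ℤ) - (j : ℕ)) (algD j)) ⊓
  twist F (-1) D
termination_by l
decreasing_by exact j.isLt

/-- `H = ∑_{j=0}^{λ-1} D_j^[2-j-λ]`. -/
def algH : Submodule K (Fin n → K) :=
  (⨆ j ∈ Finset.range (lam - 1), twist F (2 - (j : ℤ) - lam) (algD F k lam D j)) ⊔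
    twist F (2 - ((lam : ℤ) - 1) - lam) (algDLast F k lam D)

/-- The output `A_i = H ∩ D^[-i]`. -/
def algOutput (i : ℕ) : Submodule K (Fin n → K) :=
  algH F k lam D ⊓ twist F (-(i : ℤ)) D

end Algorithm

end

end Loidreau


/-! Write `y^{[t,j]}` for the grid vector `∑ β_b^[t] h_b^[j]` of Frobenius index `t` and degree `j`.
The twist `C^[t]` is spanned by the `y^{[t,j]}` with `t ≤ j < t + r`, where `r = n - k`, so every
space of the algorithm is a sum over the degrees `j` of images of "columns" in `K^λ`, and these
columns are spans of Frobenius powers of `(1, β_1, …, β_{λ-1})`. The dimension hypothesis says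
exactly that the columns of `C + C^[1] + ⋯ + C^[λ]` are independent and as large as possible, so
intersections inside this space, or one of its twists, can be computed column by column.

In this way `A` is the span of two triangles of grid vectors. Each `B_ℓ` completes them by one full
column, and meeting it with `C^[-1]` leaves the line of a single grid vector; together these lines
fill the degree `0` column, which is `H`, and `H ∩ C^[-i]` is the line of `y^{[-i,0]}`. Filling a
column uses that any `λ` of the relevant powers of `(1, β_1, …, β_{λ-1})` are independent, which is
known for one solution only. For any other solution each computed line still contains the predicted
grid vector, since the columns of two solutions have the same dimensions. -/

namespace Loidreau

noncomputable section

section ColumnSum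

variable {R ι V W : Type*} [Ring R] [AddCommGroup V] [Module R V] [AddCommGroup W] [Module R W]

/-- The sum of the images of the submodules `X j` under the maps `φ j`. The codes of the algorithm
all have this form, with the "column" `X j` sitting in Frobenius degree `j`. -/
def columnSum (φ : ι → V →ₗ[R] W) (X : ι → Submodule R V) : Submodule R W :=
  ⨆ j, (X j).map (φ j)

/-- The columns `U j` contribute independently to `columnSum φ U`: a vanishing finite sum of
vectors `φ j (x j)` with `x j ∈ U j` has only zero entries `x j`. -/
def ColumnsIndep (φ : ι → V →ₗ[R] W) (U : ι → Submodule R V) : Prop :=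
  Disjoint (Finsupp.submodule U) (LinearMap.ker (Finsupp.lsum ℕ φ))

variable {φ : ι → V →ₗ[R] W} {U X Y : ι → Submodule R V}

theorem columnSum_eq_map_lsum :
    columnSum φ X = (Finsupp.submodule X).map (Finsupp.lsum ℕ φ) := by
  simp only [columnSum, Finsupp.submodule_eq_iSup, Submodule.map_iSup, ← Submodule.map_comp,
    Finsupp.lsum_comp_lsingle]

theorem apply_mem_columnSum {j : ι} {v : V} (hv : v ∈ X j) : φ j v ∈ columnSum φ X :=
  Submodule.mem_iSup_of_mem j (Submodule.mem_map_of_mem hv)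

theorem columnSum_le {C : Submodule R W} (hX : ∀ j, ∀ v ∈ X j, φ j v ∈ C) : columnSum φ X ≤ C :=
  iSup_le fun j => Submodule.map_le_iff_le_comap.2 (hX j)

theorem columnSum_mono (hXY : ∀ j, X j ≤ Y j) : columnSum φ X ≤ columnSum φ Y :=
  iSup_mono fun j => Submodule.map_mono (hXY j)

theorem columnSum_iSup {κ : Sort*} (X : κ → ι → Submodule R V) :
    columnSum φ (fun j => ⨆ a, X a j) = ⨆ a, columnSum φ (X a) := by
  simp only [columnSum, Submodule.map_iSup]
  exact iSup_comm

theorem columnSum_update_top [DecidableEq ι] (j : ι) :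
    columnSum φ (Function.update X j ⊤) = columnSum φ X ⊔ LinearMap.range (φ j) := by
  apply le_antisymm
  · refine columnSum_le fun i v hv => ?_
    rcases eq_or_ne i j with rfl | hij
    · exact Submodule.mem_sup_right (LinearMap.mem_range_self _ v)
    · rw [Function.update_of_ne hij] at hv
      exact Submodule.mem_sup_left (apply_mem_columnSum hv)
  · refine sup_le (columnSum_mono fun i => ?_) ?_
    · rcases eq_or_ne i j with rfl | hij
      · rw [Function.update_self]
        exact le_top
      · rw [Function.update_of_ne hij]
    · rintro _ ⟨v, rfl⟩
      exact apply_mem_columnSum (by simp only [Function.update_self, Submodule.mem_top])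

theorem finsuppSubmodule_mono (hXY : ∀ j, X j ≤ Y j) :
    Finsupp.submodule X ≤ Finsupp.submodule Y :=
  fun _ hf j => hXY j (hf j)

theorem ColumnsIndep.columnSum_inf (hU : ColumnsIndep φ U) (hX : ∀ j, X j ≤ U j)
    (hY : ∀ j, Y j ≤ U j) :
    columnSum φ X ⊓ columnSum φ Y = columnSum φ fun j => X j ⊓ Y j := by
  have hinj : Set.InjOn (Finsupp.lsum ℕ φ) (Finsupp.submodule U) :=
    LinearMap.injOn_of_disjoint_ker subset_rfl hU
  have hinter : (Finsupp.submodule fun j => X j ⊓ Y j) =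
      Finsupp.submodule X ⊓ Finsupp.submodule Y := by
    ext f
    simp only [Finsupp.mem_submodule_iff, Submodule.mem_inf, forall_and]
  rw [columnSum_eq_map_lsum, columnSum_eq_map_lsum, columnSum_eq_map_lsum, hinter]
  apply SetLike.coe_injective
  simp only [Submodule.coe_inf, Submodule.map_coe]
  exact (hinj.image_inter (finsuppSubmodule_mono hX) (finsuppSubmodule_mono hY)).symm

theorem ColumnsIndep.disjoint_ker (hU : ColumnsIndep φ U) (j : ι) :
    Disjoint (U j) (LinearMap.ker (φ j)) := by
  rw [LinearMap.disjoint_ker]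
  intro v hv hv0
  have hmem : Finsupp.single j v ∈ Finsupp.submodule U := by
    rw [← Finsupp.comap_lsingle_submodule U j] at hv
    exact hv
  have hzero := LinearMap.disjoint_ker.1 hU _ hmem (by rw [Finsupp.lsum_single, hv0])
  exact Finsupp.single_eq_zero.1 hzero

end ColumnSum

section ColumnSumFinrank

open Module

variable {K ι V W : Type*} [DivisionRing K] [AddCommGroup V] [Module K V] [AddCommGroup W]
  [Module K W] {φ : ι → V →ₗ[K] W} {U X : ι → Submodule K V} {S : Finset ι}

/-- Finitely supported families in finitely many nonzero columns are plain tuples. -/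
def submoduleEquivPi (hS : ∀ j ∉ S, X j = ⊥) :
    Finsupp.submodule X ≃ₗ[K] ((j : S) → X j) :=
  LinearEquiv.ofBijective
    (LinearMap.pi fun j : S =>
      (Finsupp.lapply (j : ι) ∘ₗ (Finsupp.submodule X).subtype).codRestrict (X j)
        fun f => f.2 j) <| by
    classical
    constructor
    · intro f g hfg
      ext j
      by_cases hj : j ∈ S
      · exact congrArg Subtype.val (congrFun hfg ⟨j, hj⟩)
      · have hf := f.2 j
        have hg := g.2 j
        rw [hS j hj, Submodule.mem_bot] at hf hg
        rw [hf, hg]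
    · intro x
      refine ⟨⟨Finsupp.onFinset S (fun j => if hj : j ∈ S then x ⟨j, hj⟩ else 0)
        fun j hj => ?_, fun j => ?_⟩, ?_⟩
      · by_contra hjS
        exact hj (dif_neg hjS)
      · rw [Finsupp.onFinset_apply]
        split_ifs with hj
        exacts [(x ⟨j, hj⟩).2, zero_mem _]
      · funext j
        exact Subtype.ext (dif_pos j.2)

variable [FiniteDimensional K V]

theorem finrank_submodule (hS : ∀ j ∉ S, X j = ⊥) :
    finrank K (Finsupp.submodule X) = ∑ j ∈ S, finrank K (X j) := by
  rw [(submoduleEquivPi hS).finrank_eq, finrank_pi_fintype]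
  exact Finset.sum_coe_sort S fun j => finrank K (X j)

theorem ColumnsIndep.finrank_columnSum (hU : ColumnsIndep φ U) (hX : ∀ j, X j ≤ U j)
    (hS : ∀ j ∉ S, X j = ⊥) : finrank K (columnSum φ X) = ∑ j ∈ S, finrank K (X j) := by
  have hdisj : Disjoint (Finsupp.submodule X) (LinearMap.ker (Finsupp.lsum ℕ φ)) :=
    hU.mono_left (finsuppSubmodule_mono hX)
  rw [columnSum_eq_map_lsum, ← LinearMap.range_domRestrict,
    LinearMap.finrank_range_of_inj (LinearMap.injective_domRestrict_iff.2 hdisj),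
    finrank_submodule hS]

theorem columnsIndep_of_sum_finrank_le (hS : ∀ j ∉ S, U j = ⊥)
    (hle : ∑ j ∈ S, finrank K (U j) ≤ finrank K (columnSum φ U)) : ColumnsIndep φ U := by
  have : Module.Finite K (Finsupp.submodule U) := .equiv (submoduleEquivPi hS).symm
  apply Submodule.disjoint_ker_of_finrank_le
  rwa [finrank_submodule hS, ← columnSum_eq_map_lsum]

end ColumnSumFinrank

section SpanSingleton

theorem eq_span_singleton_of_le_span_singleton {K V : Type*} [DivisionRing K] [AddCommGroup V]
    [Module K V] {L : Submodule K V} {x y : V} (hL : L ≤ Submodule.span K {y}) (hx : x ∈ L)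
    (hx0 : x ≠ 0) : L = Submodule.span K {x} := by
  refine le_antisymm (hL.trans ?_) ((Submodule.span_singleton_le_iff_mem x L).2 hx)
  obtain ⟨a, rfl⟩ := Submodule.mem_span_singleton.1 (hL hx)
  have ha : a ≠ 0 := left_ne_zero_of_smul hx0
  rw [Submodule.span_singleton_smul_eq ha.isUnit]

end SpanSingleton

section Frobenius

variable (F : Type*) {K : Type*} [Field F] [Fintype F] [Field K] [Finite K] [Algebra F K]
variable {n : ℕ}

theorem frob_frob (i j : ℤ) (x : K) : frob F i (frob F j x) = frob F (i + j) x := by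
  unfold frob
  rw [← AlgEquiv.mul_apply, ← zpow_add]

@[simp]
theorem frobVec_frobVec (i j : ℤ) (v : Fin n → K) :
    frobVec F i (frobVec F j v) = frobVec F (i + j) v :=
  funext fun t => frob_frob F i j (v t)

@[simp]
theorem frobVec_zero_exp (v : Fin n → K) : frobVec F 0 v = v := by
  funext t
  simp [frobVec, frob]

@[simp]
theorem frobVec_zero (i : ℤ) : frobVec F i (0 : Fin n → K) = 0 :=
  funext fun _ => map_zero _

theorem frobVec_smul (i : ℤ) (a : K) (v : Fin n → K) :
    frobVec F i (a • v) = frob F i a • frobVec F i v :=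
  funext fun t => map_mul _ a (v t)

theorem frobVec_sum {ι : Type*} (S : Finset ι) (i : ℤ) (v : ι → Fin n → K) :
    frobVec F i (∑ a ∈ S, v a) = ∑ a ∈ S, frobVec F i (v a) := by
  funext t
  simp [frobVec, frob]

variable {F} in
@[simp]
theorem frobVec_eq_zero {i : ℤ} {v : Fin n → K} : frobVec F i v = 0 ↔ v = 0 := by
  refine ⟨fun h => ?_, fun h => by rw [h, frobVec_zero]⟩
  rw [← frobVec_zero_exp F v, ← neg_add_cancel i, ← frobVec_frobVec, h, frobVec_zero]

theorem twist_twist (i j : ℤ) (C : Submodule K (Fin n → K)) :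
    twist F i (twist F j C) = twist F (i + j) C := by
  ext v
  constructor
  · rintro ⟨_, ⟨c, hc, rfl⟩, rfl⟩
    exact ⟨c, hc, frobVec_frobVec F i j c⟩
  · rintro ⟨c, hc, rfl⟩
    exact ⟨_, ⟨c, hc, rfl⟩, (frobVec_frobVec F i j c).symm⟩

theorem twist_zero (C : Submodule K (Fin n → K)) : twist F 0 C = C := by
  ext v
  constructor
  · rintro ⟨c, hc, rfl⟩
    rwa [frobVec_zero_exp]
  · exact fun hv => ⟨v, hv, (frobVec_zero_exp F v).symm⟩

theorem twist_mono (i : ℤ) : Monotone (twist F i : Submodule K (Fin n → K) → _) := by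
  rintro C C' hC _ ⟨c, hc, rfl⟩
  exact ⟨c, hC hc, rfl⟩

/-- Twisting by `i`, as an automorphism of the lattice of codes of length `n`. -/
def twistIso (i : ℤ) : Submodule K (Fin n → K) ≃o Submodule K (Fin n → K) :=
  Equiv.toOrderIso
    { toFun := twist F i
      invFun := twist F (-i)
      left_inv C := by rw [twist_twist, neg_add_cancel, twist_zero]
      right_inv C := by rw [twist_twist, add_neg_cancel, twist_zero] }
    (twist_mono F i) (twist_mono F (-i))

theorem twist_inf (i : ℤ) (C C' : Submodule K (Fin n → K)) :
    twist F i (C ⊓ C') = twist F i C ⊓ twist F i C' :=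
  (twistIso F i).map_inf C C'

theorem twist_iSup {ι : Sort*} (i : ℤ) (C : ι → Submodule K (Fin n → K)) :
    twist F i (⨆ a, C a) = ⨆ a, twist F i (C a) :=
  (twistIso F i).map_iSup C

theorem twist_top (i : ℤ) : twist F i (⊤ : Submodule K (Fin n → K)) = ⊤ :=
  (twistIso F i).map_top

theorem twist_span (i : ℤ) (S : Set (Fin n → K)) :
    twist F i (Submodule.span K S) = Submodule.span K (frobVec F i '' S) := by
  apply le_antisymm
  · refine (twistIso F i).le_symm_apply.1 (Submodule.span_le.2 fun v hv => ?_)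
    refine ⟨frobVec F i v, Submodule.subset_span (Set.mem_image_of_mem _ hv), ?_⟩
    rw [frobVec_frobVec, neg_add_cancel, frobVec_zero_exp]
  · rw [Submodule.span_le]
    rintro _ ⟨v, hv, rfl⟩
    exact ⟨v, Submodule.subset_span hv, rfl⟩

end Frobenius

section Grid

open Submodule

variable (F : Type*) {K : Type*} [Field F] [Fintype F] [Field K] [Finite K] [Algebra F K]
variable {n p s : ℕ}

/-- The linear map `v ↦ ∑ v_b h_b^[j]`, placing coefficient vectors in Frobenius degree `j`. -/
def colMap (h : Fin p → Fin n → K) (j : ℤ) : (Fin p → K) →ₗ[K] (Fin n → K) :=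
  Fintype.linearCombination K fun b => frobVec F j (h b)

/-- The grid vector `∑ c_b^[t] h_b^[j]`, which is the `y^{[t,j]}` of the paper for
`c = (1, β_1, …, β_{λ-1})`. -/
def gridVec (h : Fin p → Fin n → K) (c : Fin p → K) (t j : ℤ) : Fin n → K :=
  colMap F h j (frobVec F t c)

variable (h : Fin p → Fin n → K) (c : Fin p → K)

theorem yVec_eq_gridVec (h : Fin (s + 1) → Fin n → K) (β : Fin s → K) (t j : ℤ) :
    yVec F h β t j = gridVec F h (withOne β) t j := by
  rw [gridVec, colMap, Fintype.linearCombination_apply, Fin.sum_univ_succ]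
  simp [yVec, frobVec, withOne, frob]

theorem frobVec_colMap (i j : ℤ) (v : Fin p → K) :
    frobVec F i (colMap F h j v) = colMap F h (i + j) (frobVec F i v) := by
  rw [colMap, colMap, Fintype.linearCombination_apply, Fintype.linearCombination_apply,
    frobVec_sum]
  refine Finset.sum_congr rfl fun b _ => ?_
  rw [frobVec_smul, frobVec_frobVec]
  rfl

theorem frobVec_gridVec (i t j : ℤ) :
    frobVec F i (gridVec F h c t j) = gridVec F h c (i + t) (i + j) := by
  rw [gridVec, frobVec_colMap, frobVec_frobVec, gridVec]

theorem twist_span_gridVec (i t j : ℤ) :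
    twist F i (span K {gridVec F h c t j}) = span K {gridVec F h c (i + t) (i + j)} := by
  rw [twist_span, Set.image_singleton, frobVec_gridVec]

theorem twist_map_colMap (i j : ℤ) (X : Submodule K (Fin p → K)) :
    twist F i (X.map (colMap F h j)) = (twist F i X).map (colMap F h (i + j)) := by
  ext v
  constructor
  · rintro ⟨_, ⟨x, hx, rfl⟩, rfl⟩
    exact ⟨frobVec F i x, ⟨x, hx, rfl⟩, (frobVec_colMap F h i j x).symm⟩
  · rintro ⟨_, ⟨x, hx, rfl⟩, rfl⟩
    exact ⟨_, ⟨x, hx, rfl⟩, (frobVec_colMap F h i j x).symm⟩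

theorem twist_columnSum (i : ℤ) (X : ℤ → Submodule K (Fin p → K)) :
    twist F i (columnSum (colMap F h) X) =
      columnSum (colMap F h) fun j => twist F i (X (j - i)) := by
  simp only [columnSum, twist_iSup, twist_map_colMap]
  refine (Equiv.addLeft i).iSup_congr fun j => ?_
  simp only [Equiv.coe_addLeft, add_sub_cancel_left]

variable {F h}

theorem ColumnsIndep.twist {U : ℤ → Submodule K (Fin p → K)}
    (hU : ColumnsIndep (colMap F h) U) (i : ℤ) :
    ColumnsIndep (colMap F h) fun j => twist F i (U (j - i)) := by
  rw [ColumnsIndep, LinearMap.disjoint_ker] at hU ⊢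
  intro f hf hf0
  let g : ℤ →₀ (Fin p → K) := Finsupp.equivMapDomain (Equiv.subRight i)
    (f.mapRange (frobVec F (-i)) (frobVec_zero F (-i)))
  have hg_apply (j : ℤ) : g j = frobVec F (-i) (f (j + i)) := rfl
  have hg : g ∈ Finsupp.submodule U := by
    intro j
    obtain ⟨c, hc, hfc⟩ := hf (j + i)
    rw [add_sub_cancel_right] at hc
    rwa [hg_apply, hfc, frobVec_frobVec, neg_add_cancel, frobVec_zero_exp]
  have hg0 : Finsupp.lsum ℕ (colMap F h) g = 0 := by
    rw [Finsupp.lsum_apply, Finsupp.sum_equivMapDomain,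
      Finsupp.sum_mapRange_index fun j => map_zero _, ← frobVec_zero F (-i), ← hf0,
      Finsupp.lsum_apply, Finsupp.sum, Finsupp.sum, frobVec_sum]
    refine Finset.sum_congr rfl fun j _ => ?_
    rw [frobVec_colMap, Equiv.subRight_apply, sub_eq_neg_add]
  ext1 j
  have hzero := DFunLike.congr_fun (hU g hg hg0) (j - i)
  rwa [hg_apply, sub_add_cancel, Finsupp.coe_zero, Pi.zero_apply, frobVec_eq_zero] at hzero

end Grid

section PowSpan

open Module Set Submodule
open scoped Finset

variable (F : Type*) {K : Type*} [Field F] [Fintype F] [Field K] [Finite K] [Algebra F K]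
variable {p s : ℕ}

/-- The span of the Frobenius powers `c ^ [t]` with exponents `t ∈ T`. -/
def powSpan (c : Fin p → K) (T : Set ℤ) : Submodule K (Fin p → K) :=
  span K ((fun t : ℤ => frobVec F t c) '' T)

variable {F} {c : Fin p → K} {T T' : Set ℤ} {a b a' b' t : ℤ}

theorem frobVec_mem_powSpan (ht : t ∈ T) : frobVec F t c ∈ powSpan F c T :=
  subset_span (mem_image_of_mem _ ht)

theorem powSpan_le {X : Submodule K (Fin p → K)} :
    powSpan F c T ≤ X ↔ ∀ t ∈ T, frobVec F t c ∈ X :=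
  span_le.trans forall_mem_image

theorem powSpan_mono (hT : T ⊆ T') : powSpan F c T ≤ powSpan F c T' :=
  span_mono (image_mono hT)

theorem powSpan_union : powSpan F c (T ∪ T') = powSpan F c T ⊔ powSpan F c T' := by
  rw [powSpan, image_union, span_union, powSpan, powSpan]

theorem powSpan_empty : powSpan F c ∅ = ⊥ := by
  rw [powSpan, image_empty, span_empty]

theorem twist_powSpan_Icc (i a b : ℤ) :
    twist F i (powSpan F c (Icc a b)) = powSpan F c (Icc (i + a) (i + b)) := by
  rw [powSpan, twist_span, image_image, powSpan, ← image_const_add_Icc, image_image]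
  simp only [frobVec_frobVec]

theorem finrank_powSpan_le (T : Finset ℤ) : finrank K (powSpan F c T) ≤ #T := by
  classical
  rw [powSpan, ← Finset.coe_image]
  exact (finrank_span_finset_le_card _).trans Finset.card_image_le

theorem powSpan_Icc_eq_top {c : Fin (s + 1) → K} (htop : powSpan F c (Icc 0 s) = ⊤)
    (hab : a + s ≤ b) : powSpan F c (Icc a b) = ⊤ := by
  rw [eq_top_iff, ← twist_top F a, ← htop, twist_powSpan_Icc]
  exact powSpan_mono (Icc_subset_Icc (by omega) (by omega))

theorem powSpan_Icc_le_powSpan_Icc {c : Fin (s + 1) → K} (htop : powSpan F c (Icc 0 s) = ⊤)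
    (hab : a' ≤ a ∧ b ≤ b' ∨ a' + s ≤ b' ∨ b < a) :
    powSpan F c (Icc a b) ≤ powSpan F c (Icc a' b') := by
  rcases hab with ⟨ha, hb⟩ | hlong | hempty
  · exact powSpan_mono (Icc_subset_Icc ha hb)
  · exact le_top.trans_eq (powSpan_Icc_eq_top htop hlong).symm
  · rw [Icc_eq_empty_of_lt hempty, powSpan_empty]
    exact bot_le

theorem finrank_powSpan_Icc {c : Fin (s + 1) → K} (htop : powSpan F c (Icc 0 s) = ⊤)
    (hab : b ≤ a + s) : finrank K (powSpan F c (Icc a b)) = (b + 1 - a).toNat := by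
  have hupper (a b : ℤ) : finrank K (powSpan F c (Icc a b)) ≤ (b + 1 - a).toNat := by
    rw [← Int.card_Icc, ← Finset.coe_Icc]
    exact finrank_powSpan_le _
  refine (hupper a b).antisymm ?_
  rcases lt_or_ge b a with hba | hab'
  · omega
  have hsplit : powSpan F c (Icc a b) ⊔ powSpan F c (Icc (b + 1) (a + s)) = ⊤ := by
    rw [← powSpan_union, eq_top_iff, ← powSpan_Icc_eq_top htop le_rfl]
    exact powSpan_mono fun t ht => (le_or_gt t b).imp (⟨ht.1, ·⟩) (⟨·, ht.2⟩)
  have hadd := finrank_add_le_finrank_add_finrank (powSpan F c (Icc a b))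
    (powSpan F c (Icc (b + 1) (a + s)))
  rw [hsplit, finrank_top, finrank_fin_fun] at hadd
  have := hupper (b + 1) (a + s)
  omega

end PowSpan

section GeneralPosition

open Module Set Submodule
open scoped Finset

variable (F : Type*) {K : Type*} [Field F] [Fintype F] [Field K] [Finite K] [Algebra F K]
variable {p s r : ℕ}

/-- Any `p` distinct Frobenius powers of `c : Fin p → K` whose exponents lie in a window of `r`
consecutive integers span the whole space. -/
def InGeneralPosition (r : ℕ) (c : Fin p → K) : Prop :=
  ∀ (T : Finset ℤ) (w : ℤ), #T = p → ↑T ⊆ Ico w (w + r) → powSpan F c T = ⊤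

variable {F}

theorem MooreNondegenerate.inGeneralPosition {β : Fin s → K} (hβ : MooreNondegenerate F r β) :
    InGeneralPosition F r (withOne β) := by
  intro T w hT hw
  let e := T.equivFinOfCardEq hT
  have hexp (a : Fin (s + 1)) : 0 ≤ (e.symm a : ℤ) - w ∧ (e.symm a : ℤ) - w < r := by
    have := hw (e.symm a).2
    rw [mem_Ico] at this
    omega
  let i : Fin (s + 1) → ℕ := fun a => ((e.symm a : ℤ) - w).toNat
  have hi (a : Fin (s + 1)) : (i a : ℤ) = (e.symm a : ℤ) - w := Int.toNat_of_nonneg (hexp a).1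
  have hi_inj : Function.Injective i := fun a b hab =>
    e.symm.injective (Subtype.ext (by have := hi a; have := hi b; omega))
  have hdet := hβ i hi_inj fun a => by have := hexp a; have := hi a; omega
  have hrows : span K (range (mooreMatrix F β i).row) = ⊤ :=
    (Matrix.linearIndependent_rows_of_det_ne_zero hdet).span_eq_top_of_card_eq_finrank' (by simp)
  rw [eq_top_iff, ← twist_top F w, ← hrows, twist_span, span_le]
  rintro _ ⟨_, ⟨a, rfl⟩, rfl⟩
  refine subset_span ⟨e.symm a, (e.symm a).2, ?_⟩
  have hrow : (mooreMatrix F β i).row a = frobVec F (i a) (withOne β) := rfl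
  rw [hrow, frobVec_frobVec, hi, add_sub_cancel]

variable {c : Fin p → K}

theorem InGeneralPosition.notMem_powSpan (hc : InGeneralPosition F r c) (hpr : p ≤ r)
    {T : Finset ℤ} {t w : ℤ} (ht : t ∉ T) (hT : #T < p)
    (hw : ↑(insert t T) ⊆ Ico w (w + r)) : frobVec F t c ∉ powSpan F c T := by
  intro hmem
  obtain ⟨T', hTT', hT'w, hT'⟩ : ∃ T', insert t T ⊆ T' ∧ T' ⊆ Finset.Ico w (w + r) ∧ #T' = p :=
    Finset.exists_subsuperset_card_eq (fun x hx => Finset.mem_Ico.2 (hw hx))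
      (by rw [Finset.card_insert_of_notMem ht]; omega) (by rw [Int.card_Ico]; omega)
  have htT' : t ∈ T' := hTT' (Finset.mem_insert_self t T)
  have hspan : powSpan F c (T'.erase t) = ⊤ := by
    rw [eq_top_iff, ← hc T' w hT' fun x hx => Finset.mem_Ico.1 (hT'w hx), powSpan_le]
    intro x hx
    rcases eq_or_ne x t with rfl | hxt
    · refine powSpan_mono (fun y hy => ?_) hmem
      exact Finset.mem_erase.2
        ⟨ne_of_mem_of_not_mem hy ht, hTT' (Finset.mem_insert_of_mem hy)⟩
    · exact frobVec_mem_powSpan (Finset.mem_erase.2 ⟨hxt, hx⟩)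
  have hcard := finrank_powSpan_le (F := F) (c := c) (T'.erase t)
  rw [hspan, finrank_top, finrank_fin_fun, Finset.card_erase_of_mem htT'] at hcard
  omega

theorem InGeneralPosition.notMem_powSpan_Icc {c : Fin (s + 1) → K} (hc : InGeneralPosition F r c)
    (hsr : s + 1 ≤ r) {a b t : ℤ} (hab : b < a + s) (ht : t < a ∨ b < t) (hbt : b < t + r)
    (hta : t < a + r) : frobVec F t c ∉ powSpan F c (Icc a b) := by
  rw [← Finset.coe_Icc]
  refine hc.notMem_powSpan hsr (w := min a t) ?_ ?_ ?_
  · rw [Finset.mem_Icc]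
    omega
  · rw [Int.card_Icc]
    omega
  · intro x hx
    simp only [Finset.coe_insert, Finset.coe_Icc, mem_insert_iff, mem_Icc] at hx
    rw [mem_Ico]
    omega

theorem InGeneralPosition.range_colMap_le (hc : InGeneralPosition F r c) {n : ℕ}
    {h : Fin p → Fin n → K} {C : Submodule K (Fin n → K)} {T : Finset ℤ} {w j : ℤ} (hT : #T = p)
    (hw : ↑T ⊆ Ico w (w + r)) (hC : ∀ t ∈ T, gridVec F h c t j ∈ C) :
    LinearMap.range (colMap F h j) ≤ C := by
  rw [LinearMap.range_le_iff_comap, eq_top_iff, ← hc T w hT hw, powSpan_le]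
  exact hC

end GeneralPosition

section BlockColumn

open Set Submodule

variable (F : Type*) {K : Type*} [Field F] [Fintype F] [Field K] [Finite K] [Algebra F K]
variable {n p s : ℕ}

/-- The degree `j` column of `C^[u] + C^[u+1] + ⋯ + C^[u+w]`, where `C` is the code generated by the
grid vectors of Frobenius index `0` in degrees `0, …, r - 1`; in particular `w = 0` describes the
twists of `C` itself. -/
def blockColumn (c : Fin p → K) (r w : ℕ) (u j : ℤ) : Submodule K (Fin p → K) :=
  powSpan F c (Icc (max u (j - r + 1)) (min (u + w) j))

variable {F} {c : Fin p → K} {r w : ℕ} {t u j : ℤ} {h : Fin p → Fin n → K}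

theorem twist_blockColumn (i : ℤ) :
    twist F i (blockColumn F c r w u (j - i)) = blockColumn F c r w (i + u) j := by
  rw [blockColumn, twist_powSpan_Icc, blockColumn]
  congr 2 <;> omega

theorem blockColumn_zero_width :
    blockColumn F c r 0 t j =
      if t ≤ j ∧ j < t + r then span K {frobVec F t c} else ⊥ := by
  rw [blockColumn]
  split_ifs with hj
  · have hIcc : Icc (max t (j - r + 1)) (min (t + (0 : ℕ)) j) = {t} := by
      rw [← Icc_self]
      congr 1 <;> omega
    rw [hIcc, powSpan, image_singleton]
  · rw [Icc_eq_empty_of_lt (by omega), powSpan_empty]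

theorem blockColumn_zero_width_le (hut : u ≤ t) (htu : t ≤ u + w) :
    blockColumn F c r 0 t j ≤ blockColumn F c r w u j :=
  powSpan_mono (Icc_subset_Icc (by omega) (by omega))

theorem iSup_blockColumn_zero_width :
    ⨆ i ∈ Finset.range (w + 1), blockColumn F c r 0 (i : ℤ) j = blockColumn F c r w 0 j := by
  apply le_antisymm
  · refine iSup₂_le fun i hi => blockColumn_zero_width_le (by omega) ?_
    have := Finset.mem_range.1 hi
    omega
  · refine powSpan_le.2 fun t ht => ?_
    rw [mem_Icc] at ht
    lift t to ℕ using by omega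
    exact mem_iSup_of_mem t (mem_iSup_of_mem (Finset.mem_range.2 (by omega))
      (frobVec_mem_powSpan (mem_Icc.2 (by omega))))

theorem twist_columnSum_blockColumn (i : ℤ) :
    twist F i (columnSum (colMap F h) (blockColumn F c r w u)) =
      columnSum (colMap F h) (blockColumn F c r w (i + u)) := by
  simp only [twist_columnSum, twist_blockColumn]

theorem iSup_twist_columnSum_blockColumn (w : ℕ) :
    ⨆ i ∈ Finset.range (w + 1), twist F (i : ℤ) (columnSum (colMap F h) (blockColumn F c r 0 0)) =
      columnSum (colMap F h) (blockColumn F c r w 0) := by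
  simp only [twist_columnSum_blockColumn, add_zero, ← columnSum_iSup,
    iSup_blockColumn_zero_width]

theorem span_yVec_eq_columnSum (h : Fin (s + 1) → Fin n → K) (β : Fin s → K) :
    span K {v | ∃ i : ℕ, i < r ∧ v = yVec F h β 0 i} =
      columnSum (colMap F h) (blockColumn F (withOne β) r 0 0) := by
  apply le_antisymm
  · rw [span_le]
    rintro _ ⟨i, hi, rfl⟩
    rw [yVec_eq_gridVec]
    exact apply_mem_columnSum (frobVec_mem_powSpan (mem_Icc.2 (by omega)))
  · refine columnSum_le fun j v hv => ?_
    rw [blockColumn_zero_width] at hv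
    split_ifs at hv with hj
    · obtain ⟨a, rfl⟩ := mem_span_singleton.1 hv
      rw [map_smul]
      refine smul_mem _ a (subset_span ⟨j.toNat, by omega, ?_⟩)
      rw [yVec_eq_gridVec, Int.toNat_of_nonneg hj.1, gridVec]
    · rw [(mem_bot K).1 hv, map_zero]
      exact zero_mem _

end BlockColumn

section GenericPresentation

open Module Set Submodule
open scoped Finset

variable {F : Type*} {K : Type*} [Field F] [Fintype F] [Field K] [Finite K] [Algebra F K]
variable {n s r : ℕ} {h : Fin (s + 1) → Fin n → K} {c : Fin (s + 1) → K}
variable {D : Submodule K (Fin n → K)}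

variable (F r h c D) in
/-- The code `D` is generated by the grid vectors of Frobenius index `0` in degrees `0, …, r - 1`,
and the grid is generic for it: the first `s + 1` powers of `c` span, and the columns of
`D^[0] + ⋯ + D^[s+1]` are independent. -/
structure GenericPresentation : Prop where
  eq_columnSum : D = columnSum (colMap F h) (blockColumn F c r 0 0)
  powSpan_eq_top : powSpan F c (Icc 0 s) = ⊤
  columnsIndep_zero : ColumnsIndep (colMap F h) (blockColumn F c r (s + 1) 0)

theorem finrank_blockColumn_le (hsr : s + 1 ≤ r) (j : ℤ) :
    finrank K (blockColumn F c r (s + 1) 0 j) ≤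
      #{t ∈ Finset.Icc (0 : ℤ) s | t ≤ j ∧ j ≤ t + r} := by
  have hcard : {t ∈ Finset.Icc (0 : ℤ) s | t ≤ j ∧ j ≤ t + r} =
      Finset.Icc (max 0 (j - r)) (min s j) := by
    ext t
    simp only [Finset.mem_filter, Finset.mem_Icc]
    omega
  have hexp := finrank_powSpan_le (F := F) (c := c)
    (Finset.Icc (max 0 (j - r + 1)) (min (0 + (s + 1 : ℕ)) j))
  rw [Finset.coe_Icc, ← blockColumn, Int.card_Icc] at hexp
  have hdim := finrank_le (blockColumn F c r (s + 1) 0 j)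
  rw [finrank_fin_fun] at hdim
  rw [hcard, Int.card_Icc]
  omega

theorem sum_card_degrees (s r : ℕ) :
    ∑ j ∈ Finset.Icc (0 : ℤ) (r + s), #{t ∈ Finset.Icc (0 : ℤ) s | t ≤ j ∧ j ≤ t + r} =
      (s + 1) * (r + 1) := by
  have hrow : ∀ t ∈ Finset.Icc (0 : ℤ) s,
      #{j ∈ Finset.Icc (0 : ℤ) (r + s) | t ≤ j ∧ j ≤ t + r} = r + 1 := by
    intro t ht
    rw [Finset.mem_Icc] at ht
    have hIcc : {j ∈ Finset.Icc (0 : ℤ) (r + s) | t ≤ j ∧ j ≤ t + r} = Finset.Icc t (t + r) := by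
      ext j
      simp only [Finset.mem_filter, Finset.mem_Icc]
      omega
    rw [hIcc, Int.card_Icc]
    omega
  refine (Finset.sum_card_bipartiteAbove_eq_sum_card_bipartiteBelow
    fun t j : ℤ => t ≤ j ∧ j ≤ t + r).symm.trans ((Finset.sum_congr rfl hrow).trans ?_)
  rw [Finset.sum_const, Int.card_Icc, smul_eq_mul]
  congr 1

theorem genericPresentation_of_finrank (hsr : s + 1 ≤ r)
    (hD : D = columnSum (colMap F h) (blockColumn F c r 0 0))
    (hdim : finrank K (⨆ i ∈ Finset.range (s + 2), twist F (i : ℤ) D : Submodule K (Fin n → K)) =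
      (s + 1) * r + (s + 1)) : GenericPresentation F r h c D := by
  have hbound : ∀ j ∈ Finset.Icc (0 : ℤ) (r + s), finrank K (blockColumn F c r (s + 1) 0 j) ≤
      #{t ∈ Finset.Icc (0 : ℤ) s | t ≤ j ∧ j ≤ t + r} := fun j _ => finrank_blockColumn_le hsr j
  have hsupp : ∀ j ∉ Finset.Icc (0 : ℤ) (r + s), blockColumn F c r (s + 1) 0 j = ⊥ := by
    intro j hj
    rw [Finset.mem_Icc] at hj
    rw [blockColumn, Icc_eq_empty_of_lt (by omega), powSpan_empty]
  rw [hD, iSup_twist_columnSum_blockColumn, ← mul_add_one, ← sum_card_degrees] at hdim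
  have hindep : ColumnsIndep (colMap F h) (blockColumn F c r (s + 1) 0) :=
    columnsIndep_of_sum_finrank_le hsupp ((Finset.sum_le_sum hbound).trans_eq hdim.symm)
  rw [hindep.finrank_columnSum (fun _ => le_rfl) hsupp] at hdim
  have hs := (Finset.sum_eq_sum_iff_of_le hbound).1 hdim s (Finset.mem_Icc.2 (by omega))
  refine ⟨hD, eq_top_of_finrank_eq ?_, hindep⟩
  have hIcc : Icc (max 0 ((s : ℤ) - r + 1)) (min (0 + (s + 1 : ℕ)) s) = Icc 0 (s : ℤ) := by
    congr 1 <;> omega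
  rw [blockColumn, hIcc] at hs
  rw [hs, finrank_fin_fun, Finset.filter_true_of_mem, Int.card_Icc]
  · omega
  · intro t ht
    rw [Finset.mem_Icc] at ht
    omega

namespace GenericPresentation

theorem twist_eq (H : GenericPresentation F r h c D) (t : ℤ) :
    twist F t D = columnSum (colMap F h) (blockColumn F c r 0 t) := by
  rw [H.eq_columnSum, twist_columnSum_blockColumn, add_zero]

theorem columnsIndep (H : GenericPresentation F r h c D) (u : ℤ) :
    ColumnsIndep (colMap F h) (blockColumn F c r (s + 1) u) := by
  have hu := H.columnsIndep_zero.twist u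
  simp only [twist_blockColumn, add_zero] at hu
  exact hu

theorem colMap_injective (H : GenericPresentation F r h c D) (hsr : s + 1 ≤ r) (j : ℤ) :
    Function.Injective (colMap F h j) := by
  have hdisj := (H.columnsIndep (j - s)).disjoint_ker j
  rwa [blockColumn, powSpan_Icc_eq_top H.powSpan_eq_top (by omega), disjoint_iff, top_inf_eq,
    LinearMap.ker_eq_bot] at hdisj

theorem frobVec_ne_zero (H : GenericPresentation F r h c D) (t : ℤ) : frobVec F t c ≠ 0 := by
  rw [Ne, frobVec_eq_zero]
  rintro rfl
  refine bot_ne_top (H.powSpan_eq_top ▸ (le_bot_iff.1 (powSpan_le.2 fun t _ => ?_)).symm)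
  rw [frobVec_zero]
  exact zero_mem _

theorem gridVec_ne_zero (H : GenericPresentation F r h c D) (hsr : s + 1 ≤ r) (t j : ℤ) :
    gridVec F h c t j ≠ 0 :=
  (map_ne_zero_iff _ (H.colMap_injective hsr j)).2 (H.frobVec_ne_zero t)

theorem gridVec_mem_twist (H : GenericPresentation F r h c D) {t j : ℤ} (htj : t ≤ j)
    (hjt : j < t + r) : gridVec F h c t j ∈ twist F t D := by
  rw [H.twist_eq]
  exact apply_mem_columnSum (frobVec_mem_powSpan (mem_Icc.2 (by omega)))

theorem columnSum_inf_twist_le (H : GenericPresentation F r h c D)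
    {X : ℤ → Submodule K (Fin (s + 1) → K)} {u t j₀ : ℤ} (hut : u ≤ t) (htu : t ≤ u + (s + 1))
    (hX : ∀ j, X j ≤ blockColumn F c r (s + 1) u j)
    (hnot : ∀ j, t ≤ j → j < t + r → j ≠ j₀ → frobVec F t c ∉ X j) :
    columnSum (colMap F h) X ⊓ twist F t D ≤ span K {gridVec F h c t j₀} := by
  rw [H.twist_eq, (H.columnsIndep u).columnSum_inf hX fun j =>
    blockColumn_zero_width_le hut (by omega)]
  refine columnSum_le fun j v ⟨hvX, hv⟩ => ?_
  rw [SetLike.mem_coe, blockColumn_zero_width] at hv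
  split_ifs at hv with hj
  · obtain ⟨a, rfl⟩ := mem_span_singleton.1 hv
    rw [map_smul, ← gridVec]
    rcases eq_or_ne j j₀ with rfl | hjj₀
    · exact smul_mem _ a (mem_span_singleton_self _)
    · have ha : a = 0 := by
        by_contra ha
        exact hnot j hj.1 hj.2 hjj₀ ((smul_mem_iff _ ha).1 hvX)
      rw [ha, zero_smul]
      exact zero_mem _
  · rw [(mem_bot K).1 hv, map_zero]
    exact zero_mem _

end GenericPresentation

end GenericPresentation

section AlgorithmA

open Module Set Submodule

variable {F : Type*} {K : Type*} [Field F] [Fintype F] [Field K] [Finite K] [Algebra F K]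
variable {n k s : ℕ} {h : Fin (s + 1) → Fin n → K} {c : Fin (s + 1) → K} {r : ℕ}
variable {D : Submodule K (Fin n → K)}

variable (F c r) in
/-- The degree `j` column of `S_0^[0] ∩ S_0^[-1] ∩ ⋯ ∩ S_0^[-m]`, for `0 ≤ m ≤ r - s`. -/
def interColumn (m j : ℤ) : Submodule K (Fin (s + 1) → K) :=
  if j + m + 1 ≤ r then powSpan F c (Icc 0 (min j s)) else powSpan F c (Icc (j - r + 1) (s - m))

variable (F c r) in
/-- The degree `j` column of the space `A` computed by the algorithm. -/
def algAColumn (j : ℤ) : Submodule K (Fin (s + 1) → K) :=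
  if j < s then powSpan F c (Icc 0 j) else powSpan F c (Icc (j - r + 1) (2 * s - r))

theorem twist_neg_one_interColumn (m j : ℤ) : twist F (-1) (interColumn F c r m (j - -1)) =
    if j + m + 2 ≤ r then powSpan F c (Icc (-1) (min j (s - 1)))
      else powSpan F c (Icc (j - r + 1) (s - m - 1)) := by
  have hiff : j - -1 + m + 1 ≤ r ↔ j + m + 2 ≤ r := by omega
  rw [interColumn, apply_ite (twist F (-1)), twist_powSpan_Icc, twist_powSpan_Icc,
    if_congr hiff rfl rfl]
  split_ifs <;> congr 2 <;> omega

namespace GenericPresentation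

theorem interColumn_zero (H : GenericPresentation F r h c D) (hsr : s ≤ r) (j : ℤ) :
    interColumn F c r 0 j = blockColumn F c r s 0 j := by
  have htop := H.powSpan_eq_top
  rw [interColumn, blockColumn]
  split_ifs
  all_goals
    apply le_antisymm <;> exact powSpan_Icc_le_powSpan_Icc htop (by omega)

theorem interColumn_add_one (H : GenericPresentation F r h c D) {m : ℤ} (hm : 0 ≤ m)
    (hmr : m + s + 1 ≤ r) (j : ℤ) :
    interColumn F c r (m + 1) j =
      blockColumn F c r s 0 j ⊓ twist F (-1) (interColumn F c r m (j - -1)) := by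
  have hiff : j + (m + 1) + 1 ≤ r ↔ j + m + 2 ≤ r := by omega
  rw [twist_neg_one_interColumn, interColumn, blockColumn, if_congr hiff rfl rfl]
  split_ifs
  · rw [inf_eq_left.2 (powSpan_Icc_le_powSpan_Icc H.powSpan_eq_top (by omega))]
    congr 2 <;> omega
  · rw [inf_eq_right.2 (powSpan_Icc_le_powSpan_Icc H.powSpan_eq_top (by omega)), sub_sub]

theorem algS_eq (H : GenericPresentation F r h c D) :
    algS F (s + 1) D = columnSum (colMap F h) (blockColumn F c r s 0) := by
  rw [algS, H.eq_columnSum, iSup_twist_columnSum_blockColumn]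

theorem columnSum_interColumn_add_one (H : GenericPresentation F r h c D) {m : ℤ} (hm : 0 ≤ m)
    (hmr : m + s + 1 ≤ r) :
    columnSum (colMap F h) (interColumn F c r (m + 1)) =
      algS F (s + 1) D ⊓ twist F (-1) (columnSum (colMap F h) (interColumn F c r m)) := by
  rw [H.algS_eq, twist_columnSum, (H.columnsIndep (-1)).columnSum_inf]
  · exact congrArg _ (funext (H.interColumn_add_one hm hmr))
  · exact fun j => powSpan_Icc_le_powSpan_Icc H.powSpan_eq_top (by omega)
  · intro j
    rw [twist_neg_one_interColumn, blockColumn]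
    split_ifs <;> exact powSpan_Icc_le_powSpan_Icc H.powSpan_eq_top (by omega)

/- Columns are independent only in `s + 2` consecutive twists of `D`, so the twists of `S_0` must be
intersected one at a time rather than all at once. -/
theorem iInf_twist_algS (H : GenericPresentation F r h c D) {m : ℕ} (hmr : m + s ≤ r) :
    ⨅ i ∈ Finset.range (m + 1), twist F (i : ℤ) (algS F (s + 1) D) =
      twist F m (columnSum (colMap F h) (interColumn F c r m)) := by
  induction m with
  | zero =>
    simp only [zero_add, Finset.range_one, Finset.mem_singleton, iInf_iInf_eq_left, Nat.cast_zero,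
      twist_zero, H.algS_eq, funext (H.interColumn_zero (by omega))]
  | succ m ih =>
    rw [Finset.range_add_one, Finset.iInf_insert, ih (by omega), Nat.cast_succ,
      H.columnSum_interColumn_add_one (by omega) (by omega), twist_inf, twist_twist,
      add_neg_cancel_right]

theorem algA_eq (H : GenericPresentation F (n - k) h c D) (hsr : s + 1 ≤ n - k) :
    algA F k (s + 1) D = columnSum (colMap F h) (algAColumn F c (n - k)) := by
  have hd : algd n k (s + 1) = n - k - s := by
    rw [algd]
    omega
  rw [algA, hd, H.iInf_twist_algS (by omega), twist_twist, neg_add_cancel, twist_zero]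
  congr 1
  funext j
  have hiff : j + (n - k - s : ℕ) + 1 ≤ (n - k : ℕ) ↔ j < s := by omega
  rw [interColumn, algAColumn, if_congr hiff rfl rfl]
  split_ifs <;> congr 2 <;> omega

end GenericPresentation

end AlgorithmA

section Lines

open Module Set Submodule

variable {F : Type*} {K : Type*} [Field F] [Fintype F] [Field K] [Finite K] [Algebra F K]
variable {n k s l : ℕ} {h h' : Fin (s + 1) → Fin n → K} {c c' : Fin (s + 1) → K} {r : ℕ}
variable {D : Submodule K (Fin n → K)}

variable (F k s D) in
/-- The spaces `B_l` of the algorithm, which the definition of `algD` does not name. -/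
def algB (l : ℕ) : Submodule K (Fin n → K) :=
  if l = 0 then algBZero F k (s + 1) D
    else algA F k (s + 1) D ⊔ ⨆ j : Fin l, twist F ((l : ℤ) - (j : ℕ)) (algD F k (s + 1) D j)

theorem algD_eq_algB_inf (l : ℕ) : algD F k (s + 1) D l = algB F k s D l ⊓ twist F (-1) D := by
  rw [algD, algB]

theorem algA_le_algB (l : ℕ) : algA F k (s + 1) D ≤ algB F k s D l := by
  rw [algB]
  split_ifs <;> exact le_sup_left

theorem algDLast_eq_inf (hsr : s + 1 ≤ n - k) : algDLast F k (s + 1) D =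
    twist F (s - 1) (algA F k (s + 1) D) ⊓ twist F (2 * s - (n - k : ℕ)) D := by
  rw [algDLast, algd]
  congr 2 <;> omega

variable (F k h c D) in
/-- The spaces `D_{λ-1}` and `D_j`, for `j < l`, are the lines predicted by the grid vectors of
`(h, c)`. -/
structure LinesBelow (l : ℕ) : Prop where
  last : algDLast F k (s + 1) D = span K {gridVec F h c (2 * s - (n - k : ℕ)) (2 * s - 1)}
  line : ∀ j < l, algD F k (s + 1) D j = span K {gridVec F h c (-1) (s - 1 + j)}

variable (F c) in
/-- The degree `j` column of `B_l`: that of `A`, except for a full column in degree `s - 1 + l`. -/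
def algBColumn (r l : ℕ) : ℤ → Submodule K (Fin (s + 1) → K) :=
  Function.update (algAColumn F c r) (s - 1 + l) ⊤

theorem algBColumn_self : algBColumn F c r l (s - 1 + l) = ⊤ :=
  Function.update_self ..

theorem algBColumn_of_ne {j : ℤ} (hj : j ≠ s - 1 + l) :
    algBColumn F c r l j = algAColumn F c r j :=
  Function.update_of_ne hj ..

theorem algBColumn_eq_bot (hl : l < s) {j : ℤ} (hj : j ∉ Finset.Icc (0 : ℤ) (2 * s)) :
    algBColumn F c r l j = ⊥ := by
  rw [Finset.mem_Icc] at hj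
  rw [algBColumn_of_ne (by omega), algAColumn]
  split_ifs <;> rw [Icc_eq_empty_of_lt (by omega), powSpan_empty]

theorem finrank_algBColumn (htop : powSpan F c (Icc 0 s) = ⊤) (j : ℤ) :
    finrank K (algBColumn F c r l j) =
      if j = s - 1 + l then s + 1 else if j < s then (j + 1).toNat else (2 * s - j).toNat := by
  split_ifs with hjl hj
  · rw [hjl, algBColumn_self, finrank_top, finrank_fin_fun]
  · rw [algBColumn_of_ne hjl, algAColumn, if_pos hj, finrank_powSpan_Icc htop (by omega), sub_zero]
  · rw [algBColumn_of_ne hjl, algAColumn, if_neg hj, finrank_powSpan_Icc htop (by omega)]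
    congr 1
    omega

namespace LinesBelow

theorem add_one (L : LinesBelow F k h c D l)
    (hl : algD F k (s + 1) D l = span K {gridVec F h c (-1) (s - 1 + l)}) :
    LinesBelow F k h c D (l + 1) := by
  refine ⟨L.last, fun j hj => ?_⟩
  rcases Nat.lt_succ_iff_lt_or_eq.1 hj with hj | rfl
  exacts [L.line j hj, hl]

theorem twist_last (L : LinesBelow F k h c D l) :
    twist F (1 - ((s + 1 : ℕ) : ℤ)) (algDLast F k (s + 1) D) =
      span K {gridVec F h c (s - (n - k : ℕ)) (s - 1)} := by
  rw [L.last, twist_span_gridVec]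
  congr 3 <;> omega

theorem twist_line (L : LinesBelow F k h c D l) (j : Fin l) :
    twist F ((l : ℤ) - (j : ℕ)) (algD F k (s + 1) D j) =
      span K {gridVec F h c (l - 1 - (j : ℕ)) (s - 1 + l)} := by
  rw [L.line j j.2, twist_span_gridVec]
  congr 3 <;> omega

theorem algB_zero (L : LinesBelow F k h c D 0) : algB F k s D 0 =
    algA F k (s + 1) D ⊔ span K {gridVec F h c (s - (n - k : ℕ)) (s - 1)} := by
  rw [algB, if_pos rfl, algBZero, L.twist_last]

theorem algB_of_ne_zero (L : LinesBelow F k h c D l) (hl : l ≠ 0) : algB F k s D l =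
    algA F k (s + 1) D ⊔ ⨆ j : Fin l, span K {gridVec F h c (l - 1 - (j : ℕ)) (s - 1 + l)} := by
  simp only [algB, if_neg hl, L.twist_line]

theorem algB_le (L : LinesBelow F k h c D l) :
    algB F k s D l ≤ algA F k (s + 1) D ⊔ LinearMap.range (colMap F h (s - 1 + l)) := by
  have hgrid (t : ℤ) : span K {gridVec F h c t (s - 1 + l)} ≤
      LinearMap.range (colMap F h (s - 1 + l)) :=
    (span_singleton_le_iff_mem _ _).2 (LinearMap.mem_range_self _ _)
  rcases eq_or_ne l 0 with rfl | hl
  · have hzero := hgrid (s - (n - k : ℕ))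
    rw [Nat.cast_zero, add_zero] at hzero ⊢
    rw [L.algB_zero]
    exact sup_le_sup_left hzero _
  · rw [L.algB_of_ne_zero hl]
    exact sup_le_sup_left (iSup_le fun j => hgrid _) _

end LinesBelow

namespace GenericPresentation

theorem gridVec_mem_algA_of_lt (H : GenericPresentation F (n - k) h c D) (hsr : s + 1 ≤ n - k)
    {t j : ℤ} (hj : j < s) (ht : 0 ≤ t) (htj : t ≤ j) :
    gridVec F h c t j ∈ algA F k (s + 1) D := by
  rw [H.algA_eq hsr]
  refine apply_mem_columnSum ?_
  rw [algAColumn, if_pos hj]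
  exact frobVec_mem_powSpan ⟨ht, htj⟩

theorem gridVec_mem_algA_of_le (H : GenericPresentation F (n - k) h c D) (hsr : s + 1 ≤ n - k)
    {t j : ℤ} (hj : s ≤ j) (hjt : j < t + (n - k : ℕ)) (ht : t ≤ 2 * s - (n - k : ℕ)) :
    gridVec F h c t j ∈ algA F k (s + 1) D := by
  rw [H.algA_eq hsr]
  refine apply_mem_columnSum ?_
  rw [algAColumn, if_neg hj.not_gt]
  exact frobVec_mem_powSpan (mem_Icc.2 (by omega))

theorem twist_algA_eq (H : GenericPresentation F (n - k) h c D) (hsr : s + 1 ≤ n - k) :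
    twist F (s - 1) (algA F k (s + 1) D) = columnSum (colMap F h) fun j : ℤ =>
      if j < 2 * s - 1 then powSpan F c (Icc (s - 1) j)
        else powSpan F c (Icc (j - (n - k : ℕ) + 1) (3 * s - 1 - (n - k : ℕ))) := by
  rw [H.algA_eq hsr, twist_columnSum]
  congr 1
  funext j
  have hiff : j - (s - 1) < s ↔ j < 2 * s - 1 := by omega
  rw [algAColumn, apply_ite (twist F _), twist_powSpan_Icc, twist_powSpan_Icc,
    if_congr hiff rfl rfl]
  split_ifs <;> congr 2 <;> omega

theorem gridVec_mem_algDLast (H : GenericPresentation F (n - k) h c D) (hs : 1 ≤ s)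
    (hsr : 2 * (s + 1) ≤ n - k) :
    gridVec F h c (2 * s - (n - k : ℕ)) (2 * s - 1) ∈ algDLast F k (s + 1) D := by
  rw [algDLast_eq_inf (by omega), H.twist_algA_eq (by omega)]
  refine ⟨apply_mem_columnSum ?_, H.gridVec_mem_twist (by omega) (by omega)⟩
  rw [if_neg (by omega)]
  exact frobVec_mem_powSpan (mem_Icc.2 (by omega))

theorem algDLast_le (H : GenericPresentation F (n - k) h c D) (hc : InGeneralPosition F (n - k) c)
    (hs : 1 ≤ s) (hsr : 2 * (s + 1) ≤ n - k) :
    algDLast F k (s + 1) D ≤ span K {gridVec F h c (2 * s - (n - k : ℕ)) (2 * s - 1)} := by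
  rw [algDLast_eq_inf (by omega), H.twist_algA_eq (by omega)]
  refine H.columnSum_inf_twist_le (u := 2 * s - 1 - (n - k : ℕ)) (by omega) (by omega)
    (fun j => ?_) fun j htj hjt hj => ?_
  · split_ifs <;> exact powSpan_Icc_le_powSpan_Icc H.powSpan_eq_top (by omega)
  · split_ifs <;> exact hc.notMem_powSpan_Icc (by omega) (by omega) (by omega) (by omega) (by omega)

theorem columnSum_algBColumn (H : GenericPresentation F (n - k) h c D) (hsr : s + 1 ≤ n - k)
    (l : ℕ) : columnSum (colMap F h) (algBColumn F c (n - k) l) =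
      algA F k (s + 1) D ⊔ LinearMap.range (colMap F h (s - 1 + l)) := by
  rw [algBColumn, columnSum_update_top, H.algA_eq hsr]

theorem range_colMap_le_algB_zero (H : GenericPresentation F (n - k) h c D)
    (hc : InGeneralPosition F (n - k) c) (hsr : 2 * (s + 1) ≤ n - k)
    (L : LinesBelow F k h c D 0) : LinearMap.range (colMap F h (s - 1)) ≤ algB F k s D 0 := by
  refine hc.range_colMap_le (c := c) (w := s - (n - k : ℕ))
    (T := insert (s - (n - k : ℕ) : ℤ) (Finset.Icc 0 (s - 1))) ?_ (fun t ht => ?_) fun t ht => ?_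
  · rw [Finset.card_insert_of_notMem (by rw [Finset.mem_Icc]; omega), Int.card_Icc]
    omega
  · rw [Finset.mem_coe, Finset.mem_insert, Finset.mem_Icc] at ht
    rw [mem_Ico]
    omega
  · rw [Finset.mem_insert, Finset.mem_Icc] at ht
    rcases ht with rfl | ht
    · rw [L.algB_zero]
      exact mem_sup_right (mem_span_singleton_self _)
    · exact algA_le_algB 0 (H.gridVec_mem_algA_of_lt (by omega) (by omega) ht.1 ht.2)

theorem range_colMap_le_algB_of_ne_zero (H : GenericPresentation F (n - k) h c D)
    (hc : InGeneralPosition F (n - k) c) (hsr : 2 * (s + 1) ≤ n - k) (hl0 : l ≠ 0) (hl : l < s)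
    (L : LinesBelow F k h c D l) : LinearMap.range (colMap F h (s - 1 + l)) ≤ algB F k s D l := by
  refine hc.range_colMap_le (c := c) (w := s + l - (n - k : ℕ))
    (T := Finset.Icc (s + l - (n - k : ℕ) : ℤ) (2 * s - (n - k : ℕ)) ∪ Finset.Icc 0 (l - 1 : ℤ))
    ?_ (fun t ht => ?_) fun t ht => ?_
  · rw [Finset.card_union_of_disjoint, Int.card_Icc, Int.card_Icc]
    · omega
    · rw [Finset.disjoint_left]
      intro t htlow hthigh
      rw [Finset.mem_Icc] at htlow hthigh
      omega
  · rw [Finset.mem_coe, Finset.mem_union, Finset.mem_Icc, Finset.mem_Icc] at ht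
    rw [mem_Ico]
    omega
  · rw [Finset.mem_union, Finset.mem_Icc, Finset.mem_Icc] at ht
    rcases ht with ht | ht
    · exact algA_le_algB l (H.gridVec_mem_algA_of_le (by omega) (by omega) (by omega) ht.2)
    · rw [L.algB_of_ne_zero hl0]
      obtain ⟨j, hj⟩ : ∃ j : Fin l, t = l - 1 - (j : ℕ) :=
        ⟨⟨(l - 1 - t).toNat, by omega⟩, by rw [Fin.val_mk]; omega⟩
      exact mem_sup_right (mem_iSup_of_mem j (hj ▸ mem_span_singleton_self _))

theorem algB_eq (H : GenericPresentation F (n - k) h c D) (hc : InGeneralPosition F (n - k) c)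
    (hsr : 2 * (s + 1) ≤ n - k) (hl : l < s) (L : LinesBelow F k h c D l) :
    algB F k s D l = columnSum (colMap F h) (algBColumn F c (n - k) l) := by
  rw [H.columnSum_algBColumn (by omega)]
  refine L.algB_le.antisymm (sup_le (algA_le_algB l) ?_)
  rcases eq_or_ne l 0 with rfl | hl0
  · rw [Nat.cast_zero, add_zero]
    exact H.range_colMap_le_algB_zero hc hsr L
  · exact H.range_colMap_le_algB_of_ne_zero hc hsr hl0 hl L

theorem algBColumn_le (H : GenericPresentation F r h c D) (hsr : 2 * (s + 1) ≤ r) (hl : l < s)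
    (j : ℤ) : algBColumn F c r l j ≤ blockColumn F c r (s + 1) (-1) j := by
  rcases eq_or_ne j (s - 1 + l) with rfl | hj
  · rw [blockColumn, powSpan_Icc_eq_top H.powSpan_eq_top (by omega)]
    exact le_top
  · rw [algBColumn_of_ne hj, algAColumn]
    split_ifs <;> exact powSpan_Icc_le_powSpan_Icc H.powSpan_eq_top (by omega)

theorem gridVec_mem_algD (H : GenericPresentation F (n - k) h c D) (hsr : 2 * (s + 1) ≤ n - k)
    (hl : l < s) (hB : algB F k s D l = columnSum (colMap F h) (algBColumn F c (n - k) l)) :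
    gridVec F h c (-1) (s - 1 + l) ∈ algD F k (s + 1) D l := by
  rw [algD_eq_algB_inf, hB]
  refine ⟨apply_mem_columnSum ?_, H.gridVec_mem_twist (by omega) (by omega)⟩
  rw [algBColumn_self]
  exact mem_top

theorem algD_le (H : GenericPresentation F (n - k) h c D) (hc : InGeneralPosition F (n - k) c)
    (hsr : 2 * (s + 1) ≤ n - k) (hl : l < s)
    (hB : algB F k s D l = columnSum (colMap F h) (algBColumn F c (n - k) l)) :
    algD F k (s + 1) D l ≤ span K {gridVec F h c (-1) (s - 1 + l)} := by
  rw [algD_eq_algB_inf, hB]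
  refine H.columnSum_inf_twist_le le_rfl (by omega) (H.algBColumn_le hsr hl) fun j htj hjt hj => ?_
  rw [algBColumn_of_ne hj, algAColumn]
  split_ifs <;> exact hc.notMem_powSpan_Icc (by omega) (by omega) (by omega) (by omega) (by omega)

theorem finrank_columnSum_algBColumn (H : GenericPresentation F r h c D) (hsr : 2 * (s + 1) ≤ r)
    (hl : l < s) : finrank K (columnSum (colMap F h) (algBColumn F c r l)) =
      ∑ j ∈ Finset.Icc (0 : ℤ) (2 * s),
        if j = s - 1 + l then s + 1 else if j < s then (j + 1).toNat else (2 * s - j).toNat := by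
  rw [(H.columnsIndep (-1)).finrank_columnSum (H.algBColumn_le hsr hl) fun j =>
    algBColumn_eq_bot hl]
  exact Finset.sum_congr rfl fun j _ => finrank_algBColumn H.powSpan_eq_top j

/- The inclusions `algB ≤ …` hold for every presentation `(h', c')`; that they are equalities is
known for `(h, c)` by general position, and for `(h', c')` because the dimensions agree. -/
theorem linesBelow (H : GenericPresentation F (n - k) h c D) (hc : InGeneralPosition F (n - k) c)
    (hs : 1 ≤ s) (hsr : 2 * (s + 1) ≤ n - k) (hl : l ≤ s)
    (H' : GenericPresentation F (n - k) h' c' D) : LinesBelow F k h' c' D l := by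
  induction l generalizing h' c' with
  | zero =>
    exact ⟨eq_span_singleton_of_le_span_singleton (H.algDLast_le hc hs hsr)
      (H'.gridVec_mem_algDLast hs hsr) (H'.gridVec_ne_zero (by omega) _ _), nofun⟩
  | succ l ih =>
    have hls : l < s := by omega
    have L' := ih hls.le H'
    have hB := H.algB_eq hc hsr hls (ih hls.le H)
    have hB' : algB F k s D l = columnSum (colMap F h') (algBColumn F c' (n - k) l) := by
      refine eq_of_le_of_finrank_eq ?_ ?_
      · rw [H'.columnSum_algBColumn (by omega)]
        exact L'.algB_le
      · rw [hB, H.finrank_columnSum_algBColumn hsr hls, H'.finrank_columnSum_algBColumn hsr hls]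
    exact L'.add_one (eq_span_singleton_of_le_span_singleton (H.algD_le hc hsr hls hB)
      (H'.gridVec_mem_algD hsr hls hB') (H'.gridVec_ne_zero (by omega) _ _))

end GenericPresentation

end Lines

section Output

open Module Set Submodule

variable {F : Type*} {K : Type*} [Field F] [Fintype F] [Field K] [Finite K] [Algebra F K]
variable {n k s : ℕ} {h h' : Fin (s + 1) → Fin n → K} {c c' : Fin (s + 1) → K} {r : ℕ}
variable {D : Submodule K (Fin n → K)}

namespace LinesBelow

theorem algH_eq (L : LinesBelow F k h c D s) : algH F k (s + 1) D =
    (⨆ j ∈ Finset.range s, span K {gridVec F h c (-j - s) 0}) ⊔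
      span K {gridVec F h c (1 - (n - k : ℕ)) 0} := by
  rw [algH, Nat.add_sub_cancel, L.last, twist_span_gridVec]
  congr 1
  · refine biSup_congr fun j hj => ?_
    rw [L.line j (Finset.mem_range.1 hj), twist_span_gridVec]
    congr 3 <;> omega
  · congr 3 <;> omega

theorem algH_le (L : LinesBelow F k h c D s) :
    algH F k (s + 1) D ≤ LinearMap.range (colMap F h 0) := by
  rw [L.algH_eq]
  refine sup_le (iSup₂_le fun j _ => ?_) ?_ <;>
    exact (span_singleton_le_iff_mem _ _).2 (LinearMap.mem_range_self _ _)

theorem range_colMap_le_algH (L : LinesBelow F k h c D s) (hc : InGeneralPosition F (n - k) c)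
    (hsr : 2 * (s + 1) ≤ n - k) : LinearMap.range (colMap F h 0) ≤ algH F k (s + 1) D := by
  refine hc.range_colMap_le (c := c) (w := 1 - (n - k : ℕ))
    (T := insert (1 - (n - k : ℕ) : ℤ) (Finset.Icc (1 - 2 * s) (-s))) ?_ (fun t ht => ?_)
    fun t ht => ?_
  · rw [Finset.card_insert_of_notMem (by rw [Finset.mem_Icc]; omega), Int.card_Icc]
    omega
  · rw [Finset.mem_coe, Finset.mem_insert, Finset.mem_Icc] at ht
    rw [mem_Ico]
    omega
  · rw [Finset.mem_insert, Finset.mem_Icc] at ht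
    rw [L.algH_eq]
    rcases ht with rfl | ht
    · exact mem_sup_right (mem_span_singleton_self _)
    · obtain ⟨j, rfl⟩ : ∃ j : ℕ, t = -j - s := ⟨(-t - s).toNat, by omega⟩
      exact mem_sup_left (mem_iSup_of_mem j
        (mem_iSup_of_mem (Finset.mem_range.2 (by omega)) (mem_span_singleton_self _)))

end LinesBelow

namespace GenericPresentation

theorem range_colMap_inf_twist_le (H : GenericPresentation F r h c D) (hsr : s + 1 ≤ r) {t : ℤ}
    (ht : t ≤ 0) (htr : -r < t) :
    LinearMap.range (colMap F h 0) ⊓ twist F t D ≤ span K {gridVec F h c t 0} := by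
  have hcol : LinearMap.range (colMap F h 0) ≤
      columnSum (colMap F h) (Function.update ⊥ 0 ⊤) := by
    rw [columnSum_update_top]
    exact le_sup_right
  refine (inf_le_inf_right _ hcol).trans ?_
  refine H.columnSum_inf_twist_le (u := max (1 - r) (t - s)) (by omega) (by omega)
    (fun j => ?_) fun j _ _ hj => ?_
  · rcases eq_or_ne j 0 with rfl | hj
    · rw [blockColumn, powSpan_Icc_eq_top H.powSpan_eq_top (by omega)]
      exact le_top
    · rw [Function.update_of_ne hj]
      exact bot_le
  · rw [Function.update_of_ne hj, Pi.bot_apply, mem_bot]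
    exact H.frobVec_ne_zero t

theorem algH_eq (H : GenericPresentation F (n - k) h c D) (hc : InGeneralPosition F (n - k) c)
    (hs : 1 ≤ s) (hsr : 2 * (s + 1) ≤ n - k) (H' : GenericPresentation F (n - k) h' c' D) :
    algH F k (s + 1) D = LinearMap.range (colMap F h' 0) := by
  have L := H.linesBelow hc hs hsr le_rfl H
  refine eq_of_le_of_finrank_eq (H.linesBelow hc hs hsr le_rfl H').algH_le ?_
  rw [L.algH_le.antisymm (L.range_colMap_le_algH hc hsr),
    LinearMap.finrank_range_of_inj (H.colMap_injective (by omega) 0),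
    LinearMap.finrank_range_of_inj (H'.colMap_injective (by omega) 0)]

theorem algOutput_eq (H : GenericPresentation F (n - k) h c D)
    (hc : InGeneralPosition F (n - k) c) (hs : 1 ≤ s) (hsr : 2 * (s + 1) ≤ n - k)
    (H' : GenericPresentation F (n - k) h' c' D) {i : ℕ} (hi : i < n - k) :
    algOutput F k (s + 1) D i = span K {gridVec F h' c' (-i) 0} := by
  rw [algOutput, H.algH_eq hc hs hsr H']
  refine (H'.range_colMap_inf_twist_le (by omega) (by omega) (by omega)).antisymm ?_
  rw [span_singleton_le_iff_mem]
  exact ⟨LinearMap.mem_range_self _ _, H'.gridVec_mem_twist (by omega) (by omega)⟩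

end GenericPresentation

end Output

end

end Loidreau

theorem mainTheorem1_general
    {F K : Type*} [Field F] [Fintype F] [Field K] [Finite K] [Algebra F K]
    {n k s : ℕ} {D : Submodule K (Fin n → K)} (hs : 1 ≤ s) (hlam : 2 * (s + 1) ≤ n - k)
    {h h' : Fin (s + 1) → Fin n → K} {β β' : Fin s → K}
    (hD : D = Submodule.span K {v | ∃ i : ℕ, i < n - k ∧ v = Loidreau.yVec F h β 0 i})
    (hβ : Loidreau.MooreNondegenerate F (n - k) β)
    (hdim : Module.finrank K
        (⨆ i ∈ Finset.range (s + 2), Loidreau.twist F (i : ℤ) D : Submodule K (Fin n → K)) =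
      (s + 1) * (n - k) + (s + 1))
    (hD' : D = Submodule.span K {v | ∃ i : ℕ, i < n - k ∧ v = Loidreau.yVec F h' β' 0 i})
    {i : ℕ} (hi : i < n - k) :
    Loidreau.algOutput F k (s + 1) D i =
        Submodule.span K {h' 0 + ∑ j : Fin s, Loidreau.frob F (-(i : ℤ)) (β' j) • h' j.succ} ∧
      Module.finrank K (Loidreau.algOutput F k (s + 1) D i) = 1 := by
  have H := Loidreau.genericPresentation_of_finrank (by omega)
    (hD.trans (Loidreau.span_yVec_eq_columnSum h β)) hdim
  have H' := Loidreau.genericPresentation_of_finrank (by omega)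
    (hD'.trans (Loidreau.span_yVec_eq_columnSum h' β')) hdim
  have hout := H.algOutput_eq hβ.inGeneralPosition hs hlam H' hi
  refine ⟨?_, ?_⟩
  · rw [hout, ← Loidreau.yVec_eq_gridVec]
    simp only [Loidreau.yVec, Loidreau.frobVec_zero_exp]
  · rw [hout]
    exact finrank_span_singleton (H'.gridVec_ne_zero (by omega) _ _)

theorem mainTheorem1
    {F K : Type*} [Field F] [Fintype F] [Field K] [Finite K] [Algebra F K]
    (n k s : ℕ) (Cpub : Submodule K (Fin n → K))
    (hk : Module.finrank K Cpub = k)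
    -- Here `λ = s + 1`, so `λ ≥ 2`, `λ ≤ n / (n - k + 1)` and `λ ≤ (n - k) / 2`.
    (hs : 2 ≤ s + 1)
    (hrate : (s + 1) * (n - k + 1) ≤ n)
    (hlam : 2 * (s + 1) ≤ n - k)
    -- Assumptions (1) and (3)
    (h13 : ∃ p ∈ Loidreau.solutionSet F s (n - k) (Loidreau.dualCode Cpub),
      Loidreau.MooreNondegenerate F (n - k) p.2 ∧ Loidreau.TrivialStabilizer F p.2)
    -- Assumption (2)
    (h2 : Module.finrank K
        (⨆ i ∈ Finset.range (s + 2),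
          Loidreau.twist F (i : ℤ) (Loidreau.dualCode Cpub) : Submodule K (Fin n → K)) =
      (s + 1) * (n - k) + (s + 1)) :
    ∀ p ∈ Loidreau.solutionSet F s (n - k) (Loidreau.dualCode Cpub), ∀ i : ℕ, i < n - k →
      Loidreau.algOutput F k (s + 1) (Loidreau.dualCode Cpub) i =
          Submodule.span K
            {p.1 0 + ∑ j : Fin s, Loidreau.frob F (-(i : ℤ)) (p.2 j) • p.1 j.succ} ∧
        Module.finrank K (Loidreau.algOutput F k (s + 1) (Loidreau.dualCode Cpub) i) = 1 := by
  obtain ⟨q, hq, hmoore, -⟩ := h13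
  exact fun p hp i hi => mainTheorem1_general (by omega) hlam hq.1 hmoore h2 hp.1 hi
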